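/- Let $(N,\tilde g)$ be a $4$-dimensional time-oriented Lorentzian manifold of signature $(-,+,+,+)$ with Levi-Civita connection $\tilde\nabla$, and let $M\subset N$ be a connected, smoothly embedded spacelike $3$-dimensional hypersurface with boundary (an initial data set) whose boundary $\Sigma$ has finitely many connected components $\Sigma_1,\dots,\Sigma_l$, each of them a topological $2$-sphere. Let $\mathbb S$ be the hypersurface spinor bundle of $M$, i.e. the restriction to $M$ of the (complex rank $4$) Dirac spinor bundle associated with a spin structure of $N$ near $M$, with Clifford multiplication normalised by $X\cdot X=-\tilde g(X,X)$, and denote also by $\tilde\nabla$ the lift of the Levi-Civita connection of $\tilde g$ to $\mathbb S$. Let $e_0$ be the future-directed unit normal of $M$, let $e_r$ be the outward unit normal of $\Sigma$ in $M$, and let $P_\pm=\frac12(\mathrm{Id}\pm e_0\cdot e_r\cdot)$ on $\mathbb S|_\Sigma$. Let $\phi,\psi$ be smooth sections of $\mathbb S$ over $M$ with $\tilde\nabla_X\phi=\tilde\nabla_X\psi=0$ for all vectors $X$ tangent to $M$. Suppose that for some $i$ the sections $P_+\phi|_{\Sigma_i}$, $P_+\psi|_{\Sigma_i}$ over $\Sigma_i$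 are linearly independent over $\mathbb C$, or that the sections $P_-\phi|_{\Sigma_i}$, $P_-\psi|_{\Sigma_i}$ are linearly independent over $\mathbb C$. Then $\phi$ and $\psi$ are linearly independent at every point of $M$: for each $x\in M$ the vectors $\phi(x),\psi(x)\in\mathbb S_x$ are linearly independent over $\mathbb C$. -/

import Mathlib

open Set
open scoped Manifold ContDiff Matrix

noncomputable section

namespace HypersurfaceSpinor

/-! ### Clifford algebra, Dirac matrices and the spin representation -/

/-- The signs `(-1, 1, 1, 1)` of a Lorentzian orthonormal frame `e₀, e₁, e₂, e₃`. -/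
def eps : Fin 4 → ℝ := ![-1, 1, 1, 1]

/-- The quadratic form `v ↦ v₀² - v₁² - v₂² - v₃²`. Clifford multiplication is normalised by
`v · v = - g(v, v)`, so that `e₀ · e₀ = 1` and `eᵢ · eᵢ = -1`. -/
def cliffordForm : QuadraticForm ℝ (Fin 4 → ℝ) :=
  QuadraticMap.weightedSumSquares ℝ (fun α => -eps α)

/-- The Dirac matrices. -/
def gamma : Fin 4 → Matrix (Fin 4) (Fin 4) ℂ :=
  ![!![1, 0, 0, 0; 0, 1, 0, 0; 0, 0, -1, 0; 0, 0, 0, -1],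
    !![0, 0, 0, 1; 0, 0, 1, 0; 0, -1, 0, 0; -1, 0, 0, 0],
    !![0, 0, 0, -Complex.I; 0, 0, Complex.I, 0; 0, Complex.I, 0, 0; -Complex.I, 0, 0, 0],
    !![0, 0, 1, 0; 0, 0, 0, -1; -1, 0, 0, 0; 0, 1, 0, 0]]

/-- Clifford multiplication by the vector with coordinates `v`, on the model spinor space `ℂ⁴`. -/
def gammaVec : (Fin 4 → ℝ) →ₗ[ℝ] Matrix (Fin 4) (Fin 4) ℂ :=
  Fintype.linearCombination ℝ gamma

theorem gammaVec_mul_self (v : Fin 4 → ℝ) :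
    gammaVec v * gammaVec v = algebraMap ℝ (Matrix (Fin 4) (Fin 4) ℂ) (cliffordForm v) := by
  have hI : Complex.I * Complex.I = -1 := Complex.I_mul_I
  ext i j
  simp only [gammaVec, Fintype.linearCombination_apply, Fin.sum_univ_four, Matrix.mul_apply,
    Matrix.add_apply, Matrix.smul_apply, Matrix.algebraMap_matrix_apply, cliffordForm,
    QuadraticMap.weightedSumSquares_apply, eps, Complex.real_smul, smul_eq_mul]
  fin_cases i <;> fin_cases j <;> simp [gamma] <;> first | ring1 | skip
  all_goals linear_combination ((v 2 : ℂ) ^ 2) * hI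

/-- The complex spin representation, on the whole (real) Clifford algebra. -/
def spinRep : CliffordAlgebra cliffordForm →ₐ[ℝ] Matrix (Fin 4) (Fin 4) ℂ :=
  CliffordAlgebra.lift cliffordForm ⟨gammaVec, gammaVec_mul_self⟩

theorem spinRep_ι (v : Fin 4 → ℝ) :
    spinRep (CliffordAlgebra.ι cliffordForm v) = gammaVec v := by
  simp [spinRep]

/-! ### Spacetimes -/

section Spacetime

/-- A time-oriented Lorentzian metric of signature `(-, +, +, +)` on a `4`-manifold. -/
structure Spacetime (N : Type*) [TopologicalSpace N] [ChartedSpace (EuclideanSpace ℝ (Fin 4)) N]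
    [IsManifold (𝓡 4) ∞ N] where
  /-- the metric -/
  metric (y : N) : TangentSpace (𝓡 4) y →L[ℝ] TangentSpace (𝓡 4) y →L[ℝ] ℝ
  symm (y : N) (v w : TangentSpace (𝓡 4) y) : metric y v w = metric y w v
  lorentzian (y : N) : ∃ e : Fin 4 → TangentSpace (𝓡 4) y,
    ∀ α β, metric y (e α) (e β) = if α = β then eps α else 0
  contMDiff_metric : ContMDiff (𝓡 4)
    ((𝓡 4).prod 𝓘(ℝ, EuclideanSpace ℝ (Fin 4) →L[ℝ] EuclideanSpace ℝ (Fin 4) →L[ℝ] ℝ)) ∞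
    (fun y => Bundle.TotalSpace.mk'
      (EuclideanSpace ℝ (Fin 4) →L[ℝ] EuclideanSpace ℝ (Fin 4) →L[ℝ] ℝ) y (metric y))
  /-- a continuous timelike vector field, which gives the time orientation -/
  timeField (y : N) : TangentSpace (𝓡 4) y
  continuous_timeField : Continuous (fun y =>
    (Bundle.TotalSpace.mk' (EuclideanSpace ℝ (Fin 4)) y (timeField y) : TangentBundle (𝓡 4) N))
  timelike_timeField (y : N) : metric y (timeField y) (timeField y) < 0

variable {N : Type*} [TopologicalSpace N] [ChartedSpace (EuclideanSpace ℝ (Fin 4)) N]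
  [IsManifold (𝓡 4) ∞ N]

/-- Future-directed timelike vectors. -/
def Spacetime.IsFuture (g : Spacetime N) {y : N} (v : TangentSpace (𝓡 4) y) : Prop :=
  g.metric y v v < 0 ∧ g.metric y (g.timeField y) v < 0

/-- Connections on the tangent bundle of `N`. -/
abbrev Connection (N : Type*) [TopologicalSpace N] [ChartedSpace (EuclideanSpace ℝ (Fin 4)) N]
    [IsManifold (𝓡 4) ∞ N] :=
  CovariantDerivative (𝓡 4) (EuclideanSpace ℝ (Fin 4)) (fun y : N => TangentSpace (𝓡 4) y)

/-- `D` is the Levi-Civita connection of the spacetime metric: torsion-free and metric.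
In Mathlib's argument order `D Y y v` is `(∇̃_v Y)(y)`. -/
structure Spacetime.IsLeviCivita (g : Spacetime N) (D : Connection N) : Prop where
  torsion_free : D.torsion = 0
  metric : ∀ (y : N) (Y Z : ∀ z : N, TangentSpace (𝓡 4) z),
    MDifferentiableAt (𝓡 4) ((𝓡 4).prod 𝓘(ℝ, EuclideanSpace ℝ (Fin 4)))
      (fun z => Bundle.TotalSpace.mk' (EuclideanSpace ℝ (Fin 4)) z (Y z)) y →
    MDifferentiableAt (𝓡 4) ((𝓡 4).prod 𝓘(ℝ, EuclideanSpace ℝ (Fin 4)))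
      (fun z => Bundle.TotalSpace.mk' (EuclideanSpace ℝ (Fin 4)) z (Z z)) y →
    ∀ v : TangentSpace (𝓡 4) y,
      mfderiv (𝓡 4) 𝓘(ℝ, ℝ) (fun z => g.metric z (Y z) (Z z)) y v =
        g.metric y (D Y y v) (Z y) + g.metric y (Y y) (D Z y v)

end Spacetime

/-! ### Spin structures, spinors and the spin connection -/

section Spin

variable {N : Type*} [TopologicalSpace N] [ChartedSpace (EuclideanSpace ℝ (Fin 4)) N]
  [IsManifold (𝓡 4) ∞ N]

/-- Coordinates `v^α = ε_α g(e_α, v)` of the tangent vector `v` in the orthonormal frame `e`. -/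
def frameCoord (g : Spacetime N) {y : N} (e : Fin 4 → TangentSpace (𝓡 4) y)
    (v : TangentSpace (𝓡 4) y) : Fin 4 → ℝ :=
  fun α => eps α * g.metric y (e α) v

/-- A spin structure on a neighbourhood of a set `K` of the spacetime: an open cover of `K`,
smooth orthonormal frames with future-directed `e₀` on its members, and, on overlaps, smooth lifts
to the spin group of the changes of frame, which satisfy the cocycle condition. -/
structure SpinStructure (g : Spacetime N) (K : Set N) where
  /-- labels of the local frames -/
  Idx : Type*
  /-- the domain of a local frame -/
  dom : Idx → Set N
  isOpen_dom : ∀ i, IsOpen (dom i)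
  covers : K ⊆ ⋃ i, dom i
  /-- the local orthonormal frames `e₀, e₁, e₂, e₃`; only their values on the domain matter -/
  frame : Idx → Fin 4 → ∀ y : N, TangentSpace (𝓡 4) y
  contMDiffOn_frame : ∀ i α, ContMDiffOn (𝓡 4) ((𝓡 4).prod 𝓘(ℝ, EuclideanSpace ℝ (Fin 4))) ∞
    (fun y => Bundle.TotalSpace.mk' (EuclideanSpace ℝ (Fin 4)) y (frame i α y)) (dom i)
  orthonormal : ∀ i, ∀ y ∈ dom i, ∀ α β,
    g.metric y (frame i α y) (frame i β y) = if α = β then eps α else 0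
  future : ∀ i, ∀ y ∈ dom i, g.IsFuture (frame i 0 y)
  /-- lifts of the changes of frame -/
  trans : Idx → Idx → N → spinGroup cliffordForm
  contMDiffOn_trans : ∀ i j a b, ContMDiffOn (𝓡 4) 𝓘(ℝ, ℂ) ∞
    (fun y => spinRep (trans i j y : CliffordAlgebra cliffordForm) a b) (dom i ∩ dom j)
  cocycle : ∀ i j k, ∀ y ∈ dom i ∩ dom j ∩ dom k, trans i j y * trans j k y = trans i k y
  lifts : ∀ i j, ∀ y ∈ dom i ∩ dom j, ∀ v : TangentSpace (𝓡 4) y,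
    (trans i j y : CliffordAlgebra cliffordForm) *
        CliffordAlgebra.ι cliffordForm (frameCoord g (fun α => frame j α y) v) =
      CliffordAlgebra.ι cliffordForm (frameCoord g (fun α => frame i α y) v) *
        (trans i j y : CliffordAlgebra cliffordForm)

namespace SpinStructure

variable {g : Spacetime N} {K : Set N} (S : SpinStructure g K)

/-- The fibre at `y` of the spinor bundle, i.e. of the complex vector bundle associated with the
spin structure by the spin representation: a spinor at `y` has a component in `ℂ⁴` with respect to
each local frame around `y`, and these are related by the spin representation. -/
def fiber (y : N) : Submodule ℂ ({i : S.Idx // y ∈ S.dom i} → Fin 4 → ℂ) where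
  carrier := {s | ∀ i j, s i = spinRep (S.trans i.1 j.1 y) *ᵥ s j}
  zero_mem' := by intro i j; simp
  add_mem' := by
    intro s t hs ht i j
    rw [Pi.add_apply, Pi.add_apply, hs i j, ht i j, Matrix.mulVec_add]
  smul_mem' := by
    intro c s hs i j
    rw [Pi.smul_apply, Pi.smul_apply, hs i j, Matrix.mulVec_smul]

/-- Clifford multiplication `s ↦ v · s` by a tangent vector `v` of the spacetime. -/
def cliff {y : N} (v : TangentSpace (𝓡 4) y) : S.fiber y →ₗ[ℂ] S.fiber y where
  toFun s := ⟨fun i => gammaVec (frameCoord g (fun α => S.frame i.1 α y) v) *ᵥ s.1 i, by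
    intro i j
    have h := congrArg spinRep (S.lifts i.1 j.1 y ⟨i.2, j.2⟩ v)
    rw [map_mul, map_mul, spinRep_ι, spinRep_ι] at h
    beta_reduce
    rw [s.2 i j, Matrix.mulVec_mulVec, Matrix.mulVec_mulVec, h]⟩
  map_add' s t := Subtype.ext (funext fun i => Matrix.mulVec_add _ (s.1 i) (t.1 i))
  map_smul' c s := Subtype.ext (funext fun i => Matrix.mulVec_smul _ c (s.1 i))

/-- The matrix `¼ ∑ ε_α ε_β g(∇̃_v e_α, e_β) γ_α γ_β` of the spin connection in a local frame. -/
def connMatrix (D : Connection N) (i : S.Idx) {y : N} (v : TangentSpace (𝓡 4) y) :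
    Matrix (Fin 4) (Fin 4) ℂ :=
  (1 / 4 : ℝ) • ∑ α, ∑ β,
    (eps α * eps β * g.metric y (D (S.frame i α) y v) (S.frame i β y)) • (gamma α * gamma β)

end SpinStructure

end Spin

/-! ### Spacelike hypersurfaces with boundary -/

section Hypersurface

variable {N : Type*} [TopologicalSpace N] [ChartedSpace (EuclideanSpace ℝ (Fin 4)) N]
  [IsManifold (𝓡 4) ∞ N]

/-- A smooth embedding of the `3`-manifold with boundary `M` into the spacetime as a spacelike
hypersurface. -/
structure SpacelikeHypersurface (g : Spacetime N) (M : Type*) [TopologicalSpace M]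
    [ChartedSpace (EuclideanHalfSpace 3) M] [IsManifold (𝓡∂ 3) ∞ M] where
  /-- the inclusion of `M` in the spacetime -/
  emb : M → N
  contMDiff_emb : ContMDiff (𝓡∂ 3) (𝓡 4) ∞ emb
  isEmbedding : Topology.IsEmbedding emb
  spacelike : ∀ (x : M) (X : TangentSpace (𝓡∂ 3) x), X ≠ 0 →
    0 < g.metric (emb x) (mfderiv (𝓡∂ 3) (𝓡 4) emb x X) (mfderiv (𝓡∂ 3) (𝓡 4) emb x X)

variable {M : Type*} [TopologicalSpace M] [ChartedSpace (EuclideanHalfSpace 3) M]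
  [IsManifold (𝓡∂ 3) ∞ M]

/-- The sets `B 0, …, B (l - 1)` are the connected components of the boundary of `M`, and each of
them is a topological `2`-sphere. -/
structure AreBoundarySpheres {l : ℕ} (B : Fin l → Set M) : Prop where
  injective : Function.Injective B
  isComponent : ∀ k, ∃ x ∈ (𝓡∂ 3).boundary M, B k = connectedComponentIn ((𝓡∂ 3).boundary M) x
  covers : (𝓡∂ 3).boundary M ⊆ ⋃ k, B k
  sphere : ∀ k, Nonempty (B k ≃ₜ Metric.sphere (0 : EuclideanSpace ℝ (Fin 3)) 1)

/-- For a boundary point `x`, the derivative at `x` of the coordinate `x₀ ≥ 0` of the preferred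
chart, which vanishes on the boundary: the vector `X` is tangent to the boundary when the value is
`0`, and points outwards when it is negative. -/
def inwardCoord (x : M) (X : TangentSpace (𝓡∂ 3) x) : ℝ :=
  (show EuclideanSpace ℝ (Fin 3) from
    mfderiv (𝓡∂ 3) 𝓘(ℝ, EuclideanSpace ℝ (Fin 3)) (extChartAt (𝓡∂ 3) x) x X) 0

namespace SpacelikeHypersurface

variable {g : Spacetime N} (F : SpacelikeHypersurface g M)

/-- The vector of the spacetime given by a vector tangent to `M`. -/
def push {x : M} (X : TangentSpace (𝓡∂ 3) x) : TangentSpace (𝓡 4) (F.emb x) :=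
  mfderiv (𝓡∂ 3) (𝓡 4) F.emb x X

/-- `n` is the future-directed unit normal `e₀` to `M` at `x`. -/
structure IsFutureUnitNormal (x : M) (n : TangentSpace (𝓡 4) (F.emb x)) : Prop where
  unit : g.metric (F.emb x) n n = -1
  normal : ∀ X : TangentSpace (𝓡∂ 3) x, g.metric (F.emb x) n (F.push X) = 0
  future : g.IsFuture n

/-- `r` is the unit vector `e_r` tangent to `M`, orthogonal to the boundary at the boundary point
`x` and pointing out of `M`. -/
structure IsOutwardUnitNormal (x : M) (r : TangentSpace (𝓡∂ 3) x) : Prop where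
  unit : g.metric (F.emb x) (F.push r) (F.push r) = 1
  normal : ∀ X : TangentSpace (𝓡∂ 3) x, inwardCoord x X = 0 →
    g.metric (F.emb x) (F.push r) (F.push X) = 0
  outward : inwardCoord x r < 0

/-- Spinor fields: sections over `M` of the spinor bundle of the spacetime, i.e. of the
hypersurface spinor bundle. -/
abbrev SpinorField (S : SpinStructure g (range F.emb)) :=
  ∀ x : M, S.fiber (F.emb x)

variable {S : SpinStructure g (range F.emb)}

open Classical in
/-- The component of a spinor field in a local frame (`0` outside of the domain of the frame). -/
def component (φ : F.SpinorField S) (i : S.Idx) (x : M) : Fin 4 → ℂ :=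
  if h : F.emb x ∈ S.dom i then (φ x).1 ⟨i, h⟩ else 0

/-- Smooth spinor fields. -/
def IsSmooth (φ : F.SpinorField S) : Prop :=
  ∀ i, ContMDiffOn (𝓡∂ 3) 𝓘(ℝ, Fin 4 → ℂ) ∞ (F.component φ i) (F.emb ⁻¹' S.dom i)

/-- The component in a local frame of the covariant derivative `∇̃_X φ`, where `X` is tangent to
`M` and `∇̃` is the lift of the connection `D` to the spinor bundle. -/
def spinDeriv (D : Connection N) (φ : F.SpinorField S) (i : S.Idx) (x : M)
    (X : TangentSpace (𝓡∂ 3) x) : Fin 4 → ℂ :=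
  (show Fin 4 → ℂ from mfderiv (𝓡∂ 3) 𝓘(ℝ, Fin 4 → ℂ) (F.component φ i) x X) +
    S.connMatrix D i (F.push X) *ᵥ F.component φ i x

/-- `∇̃_X φ = 0` for all vectors `X` tangent to `M`. -/
def IsParallel (D : Connection N) (φ : F.SpinorField S) : Prop :=
  ∀ (x : M) (i : S.Idx), F.emb x ∈ S.dom i → ∀ X : TangentSpace (𝓡∂ 3) x,
    F.spinDeriv D φ i x X = 0

variable (S) in
/-- `P₊ = ½ (Id + e₀ · e_r ·)`. -/
def projPlus {x : M} (n : TangentSpace (𝓡 4) (F.emb x)) (r : TangentSpace (𝓡∂ 3) x) :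
    S.fiber (F.emb x) →ₗ[ℂ] S.fiber (F.emb x) :=
  (1 / 2 : ℂ) • (LinearMap.id + S.cliff n ∘ₗ S.cliff (F.push r))

variable (S) in
/-- `P₋ = ½ (Id - e₀ · e_r ·)`. -/
def projMinus {x : M} (n : TangentSpace (𝓡 4) (F.emb x)) (r : TangentSpace (𝓡∂ 3) x) :
    S.fiber (F.emb x) →ₗ[ℂ] S.fiber (F.emb x) :=
  (1 / 2 : ℂ) • (LinearMap.id - S.cliff n ∘ₗ S.cliff (F.push r))

end SpacelikeHypersurface

end Hypersurface

end HypersurfaceSpinor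

end

/-! Evaluation at a point is injective on parallel spinor fields. In a local frame, a parallel
spinor field restricted to a curve solves the linear equation `u' = -A u`, where `A` is the matrix
of the spin connection in the direction of the velocity. Nearby points are joined by segments in a
chart, so the zero set of the field is open as well as closed. The uniqueness theorem for the
equation needs `A` to be continuous, and this comes from Koszul's formula, which expresses the
Levi-Civita connection in an orthonormal frame through the Lie brackets of the frame. At the
boundary, a linear relation between the spinor fields persists under the projections `P₊` and `P₋`,
so independence of the projections forces independence of the fields.
-/

namespace HypersurfaceSpinor

section Preliminaries

theorem linearIndependent_pair_of_map {R V W : Type*} [Ring R] [AddCommGroup V] [Module R V]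
    [AddCommGroup W] [Module R W] (T : V →ₗ[R] W) {v w : V}
    (h : LinearIndependent R ![T v, T w]) : LinearIndependent R ![v, w] := by
  rw [LinearIndependent.pair_iff] at h ⊢
  intro a b hab
  exact h a b (by rw [← map_smul, ← map_smul, ← map_add, hab, map_zero])

theorem linearIndependent_pair_of_pi_map {R X Y : Type*} [Ring R] {V : X → Type*} {W : Y → Type*}
    [∀ x, AddCommGroup (V x)] [∀ x, Module R (V x)] [∀ y, AddCommGroup (W y)]
    [∀ y, Module R (W y)] {f : Y → X} (T : ∀ y, V (f y) →ₗ[R] W y) {v w : ∀ x, V x}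
    (h : LinearIndependent R ![fun y ↦ T y (v (f y)), fun y ↦ T y (w (f y))]) :
    LinearIndependent R ![v, w] :=
  linearIndependent_pair_of_map (LinearMap.pi fun y ↦ T y ∘ₗ LinearMap.proj (f y)) h

theorem eqOn_zero_of_hasDerivWithinAt_mulVec {n R : Type*} [Fintype n] [NormedRing R]
    [NormedSpace ℝ R] {A : ℝ → Matrix n n R} {u : ℝ → n → R} {a b : ℝ}
    (hA : ContinuousOn A (Icc a b))
    (hu : ∀ t ∈ Icc a b, HasDerivWithinAt u (A t *ᵥ u t) (Icc a b) t) (ha : u a = 0) :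
    EqOn u 0 (Icc a b) := by
  let : NormedAddCommGroup (Matrix n n R) := Matrix.linftyOpNormedAddCommGroup
  obtain ⟨C, hC⟩ := isCompact_Icc.exists_bound_of_continuousOn hA
  refine eq_zero_of_abs_deriv_le_mul_abs_self_of_eq_zero_right (K := C)
    (fun t ht ↦ (hu t ht).continuousWithinAt)
    (fun t ht ↦ (hu t (Ico_subset_Icc_self ht)).mono_of_mem_nhdsWithin (Icc_mem_nhdsGE_of_mem ht))
    ha fun t ht ↦ ?_
  calc ‖A t *ᵥ u t‖ ≤ ‖A t‖ * ‖u t‖ := Matrix.linfty_opNorm_mulVec _ _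
    _ ≤ C * ‖u t‖ := by gcongr; exact hC t (Ico_subset_Icc_self ht)

variable {E : Type*} [NormedAddCommGroup E] [NormedSpace ℝ E] {H : Type*} [TopologicalSpace H]
  {I : ModelWithCorners ℝ E H} {P : Type*} [TopologicalSpace P] [ChartedSpace H P]

theorem contMDiffOn_velocity [IsManifold I 1 P] {m n : WithTop ℕ∞} {c : ℝ → P} {s : Set ℝ}
    (hc : ContMDiffOn 𝓘(ℝ, ℝ) I n c s) (hmn : m + 1 ≤ n) (hs : UniqueDiffOn ℝ s) :
    ContMDiffOn 𝓘(ℝ, ℝ) I.tangent m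
      (fun t ↦ (⟨c t, mfderivWithin 𝓘(ℝ, ℝ) I c s t (1 : ℝ)⟩ : TangentBundle I P)) s := by
  have hone : ContMDiff 𝓘(ℝ, ℝ) 𝓘(ℝ, ℝ).tangent m
      (fun t : ℝ ↦ (⟨t, (1 : ℝ)⟩ : TangentBundle 𝓘(ℝ, ℝ) ℝ)) :=
    contMDiff_vectorSpace_iff_contDiff.2 contDiff_const
  exact (hc.contMDiffOn_tangentMapWithin hmn hs.uniqueMDiffOn).comp hone.contMDiffOn fun t ht ↦ ht

variable (I) in
theorem eventually_exists_contMDiffOn_curve {n : WithTop ℕ∞} [IsManifold I n P] {U : Set P}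
    {x : P} (hU : U ∈ nhds x) :
    ∀ᶠ y in nhds x, ∃ c : ℝ → P, ContMDiffOn 𝓘(ℝ, ℝ) I n c (Icc 0 1) ∧
      MapsTo c (Icc 0 1) U ∧ c 0 = x ∧ c 1 = y := by
  set e := extChartAt I x
  have hxe : x ∈ e.source := mem_extChartAt_source x
  have hpre : e.target ∩ e.symm ⁻¹' U ∈ nhdsWithin (e x) (range I) :=
    Filter.inter_mem (extChartAt_target_mem_nhdsWithin x)
      (mem_nhdsWithin_of_mem_nhds (extChartAt_preimage_mem_nhds hU))
  obtain ⟨r, hr, hball⟩ := Metric.mem_nhdsWithin_iff.1 hpre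
  have hconv : Convex ℝ (Metric.ball (e x) r ∩ range I) := (convex_ball _ _).inter I.convex_range
  have hmem (z : P) (hz : z ∈ e.source) (hzr : e z ∈ Metric.ball (e x) r) :
      e z ∈ Metric.ball (e x) r ∩ range I :=
    ⟨hzr, extChartAt_target_subset_range x (e.map_source hz)⟩
  filter_upwards [extChartAt_source_mem_nhds (I := I) x,
    (continuousAt_extChartAt (I := I) x).preimage_mem_nhds (Metric.ball_mem_nhds _ hr)]
    with y hy hyr
  let segment : ℝ → E := AffineMap.lineMap (e x) (e y)
  have hsegment : MapsTo segment (Icc 0 1) (e.target ∩ e.symm ⁻¹' U) := fun t ht ↦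
    hball (hconv.lineMap_mem (hmem x hxe (Metric.mem_ball_self hr)) (hmem y hy hyr) ht)
  have hsmooth : ContDiff ℝ n segment := (ContinuousAffineMap.lineMap (R := ℝ) (e x) (e y)).contDiff
  refine ⟨e.symm ∘ segment, ?_, fun t ht ↦ (hsegment ht).2, ?_, ?_⟩
  · exact (contMDiffOn_extChartAt_symm x).comp hsmooth.contMDiff.contMDiffOn
      fun t ht ↦ (hsegment ht).1
  · simp [segment, e.left_inv hxe]
  · simp [segment, e.left_inv hy]

end Preliminaries

section Frames

variable {N : Type*} [TopologicalSpace N] [ChartedSpace (EuclideanSpace ℝ (Fin 4)) N]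
  [IsManifold (𝓡 4) ∞ N]

theorem eps_mul_eps_self (α : Fin 4) : eps α * eps α = 1 := by
  fin_cases α <;> simp [eps]

theorem frameCoord_sum_smul (g : Spacetime N) {y : N} {e : Fin 4 → TangentSpace (𝓡 4) y}
    (he : ∀ α β, g.metric y (e α) (e β) = if α = β then eps α else 0) (c : Fin 4 → ℝ) :
    frameCoord g e (∑ α, c α • e α) = c := by
  funext β
  simp only [frameCoord, map_sum, map_smul, he, smul_eq_mul, mul_ite, mul_zero,
    Finset.sum_ite_eq, Finset.mem_univ, if_true]
  linear_combination c β * eps_mul_eps_self β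

theorem sum_frameCoord_smul (g : Spacetime N) {y : N} {e : Fin 4 → TangentSpace (𝓡 4) y}
    (he : ∀ α β, g.metric y (e α) (e β) = if α = β then eps α else 0)
    (v : TangentSpace (𝓡 4) y) : ∑ α, frameCoord g e v α • e α = v := by
  have hli : LinearIndependent ℝ e := Fintype.linearIndependent_iff.2 fun c hc α ↦ by
    rw [← frameCoord_sum_smul g he c, hc]
    simp [frameCoord]
  have hspan : Submodule.span ℝ (range e) = ⊤ := hli.span_eq_top_of_card_eq_finrank <| by
    change _ = Module.finrank ℝ (EuclideanSpace ℝ (Fin 4))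
    simp
  have hv : v ∈ Submodule.span ℝ (range e) := hspan ▸ Submodule.mem_top
  obtain ⟨c, rfl⟩ := (Submodule.mem_span_range_iff_exists_fun ℝ).1 hv
  rw [frameCoord_sum_smul g he]

theorem Spacetime.contMDiffWithinAt_metric (g : Spacetime N)
    {E : Type*} [NormedAddCommGroup E] [NormedSpace ℝ E] {H : Type*} [TopologicalSpace H]
    {I : ModelWithCorners ℝ E H} {P : Type*} [TopologicalSpace P] [ChartedSpace H P]
    {n : ℕ∞} {b : P → N} {v w : ∀ p, TangentSpace (𝓡 4) (b p)} {s : Set P} {p : P}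
    (hv : ContMDiffWithinAt I (𝓡 4).tangent n (fun p ↦ (⟨b p, v p⟩ : TangentBundle (𝓡 4) N)) s p)
    (hw : ContMDiffWithinAt I (𝓡 4).tangent n (fun p ↦ (⟨b p, w p⟩ : TangentBundle (𝓡 4) N)) s p) :
    ContMDiffWithinAt I 𝓘(ℝ, ℝ) n (fun p ↦ g.metric (b p) (v p) (w p)) s p := by
  have hb : ContMDiffWithinAt I (𝓡 4) n b s p := (Bundle.contMDiffWithinAt_totalSpace.1 hv).1
  have hgvw : ContMDiffWithinAt I ((𝓡 4).prod 𝓘(ℝ)) n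
      (fun p ↦ Bundle.TotalSpace.mk' ℝ (E := Bundle.Trivial N ℝ) (b p)
        (g.metric (b p) (v p) (w p))) s p := by
    apply ContMDiffWithinAt.clm_bundle_apply₂ (F₁ := EuclideanSpace ℝ (Fin 4))
      (F₂ := EuclideanSpace ℝ (Fin 4)) _ hv hw
    exact (g.contMDiff_metric.contMDiffAt.of_le
      (by exact_mod_cast le_top)).comp_contMDiffWithinAt p hb
  exact (Bundle.contMDiffWithinAt_totalSpace.1 hgvw).2

end Frames

namespace SpinStructure

variable {N : Type*} [TopologicalSpace N] [ChartedSpace (EuclideanSpace ℝ (Fin 4)) N]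
  [IsManifold (𝓡 4) ∞ N] {g : Spacetime N} {K : Set N} (S : SpinStructure g K)

theorem contMDiffAt_frame (i : S.Idx) (α : Fin 4) {y : N} (hy : y ∈ S.dom i) :
    ContMDiffAt (𝓡 4) (𝓡 4).tangent ∞
      (fun y ↦ (⟨y, S.frame i α y⟩ : TangentBundle (𝓡 4) N)) y :=
  (S.contMDiffOn_frame i α).contMDiffAt ((S.isOpen_dom i).mem_nhds hy)

theorem mdifferentiableAt_frame (i : S.Idx) (α : Fin 4) {y : N} (hy : y ∈ S.dom i) :
    MDifferentiableAt (𝓡 4) (𝓡 4).tangent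
      (fun y ↦ (⟨y, S.frame i α y⟩ : TangentBundle (𝓡 4) N)) y :=
  (S.contMDiffAt_frame i α hy).mdifferentiableAt (by simp)

/-- The structure functions `g([e_α, e_β], e_δ)` of a local frame, which determine the Levi-Civita
connection in that frame. -/
noncomputable def structureFun (i : S.Idx) (α β δ : Fin 4) (y : N) : ℝ :=
  g.metric y (VectorField.mlieBracket (𝓡 4) (S.frame i α) (S.frame i β) y) (S.frame i δ y)

theorem continuousOn_structureFun (i : S.Idx) (α β δ : Fin 4) :
    ContinuousOn (S.structureFun i α β δ) (S.dom i) := by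
  intro y hy
  have : IsManifold (𝓡 4) (minSmoothness ℝ 2) N := by
    rw [minSmoothness_of_isRCLikeNormedField]
    infer_instance
  have : IsManifold (𝓡 4) ((1 : ℕ∞) + 1) N := IsManifold.of_le (n := ∞) (by exact_mod_cast le_top)
  have hbracket := ContMDiffAt.mlieBracket_vectorField (n := 1) (m := 0) (I := 𝓡 4)
    ((S.contMDiffAt_frame i α hy).of_le (by exact_mod_cast le_top))
    ((S.contMDiffAt_frame i β hy).of_le (by exact_mod_cast le_top))
    (by simp)
  exact (g.contMDiffWithinAt_metric (n := 0) hbracket.contMDiffWithinAt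
    ((S.contMDiffAt_frame i δ hy).of_le (by simp)).contMDiffWithinAt).continuousWithinAt

section LeviCivita

variable {D : Connection N} (hD : g.IsLeviCivita D)
include hD

theorem metric_connection_frame_add_swap (i : S.Idx) (α β : Fin 4) {y : N} (hy : y ∈ S.dom i)
    (v : TangentSpace (𝓡 4) y) :
    g.metric y (D (S.frame i α) y v) (S.frame i β y) +
      g.metric y (D (S.frame i β) y v) (S.frame i α y) = 0 := by
  have hconst : (fun z ↦ g.metric z (S.frame i α z) (S.frame i β z)) =ᶠ[nhds y]
      fun _ ↦ if α = β then eps α else 0 := by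
    filter_upwards [(S.isOpen_dom i).mem_nhds hy] with z hz using S.orthonormal i z hz α β
  have hmetric := hD.metric y _ _ (S.mdifferentiableAt_frame i α hy)
    (S.mdifferentiableAt_frame i β hy) v
  rw [hconst.mfderiv_eq, mfderiv_const] at hmetric
  rw [g.symm y (D (S.frame i β) y v)]
  exact hmetric.symm.trans rfl

theorem structureFun_eq_sub (i : S.Idx) (α β δ : Fin 4) {y : N} (hy : y ∈ S.dom i) :
    S.structureFun i α β δ y =
      g.metric y (D (S.frame i β) y (S.frame i α y)) (S.frame i δ y) -
        g.metric y (D (S.frame i α) y (S.frame i β y)) (S.frame i δ y) := by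
  rw [structureFun, ← D.torsion_eq_zero_iff.1 hD.torsion_free (S.mdifferentiableAt_frame i α hy)
    (S.mdifferentiableAt_frame i β hy), map_sub]
  rfl

/-- Koszul's formula. The derivatives of the metric coefficients are missing because the frame is
orthonormal. -/
theorem metric_connection_frame (i : S.Idx) (α β δ : Fin 4) {y : N} (hy : y ∈ S.dom i) :
    g.metric y (D (S.frame i β) y (S.frame i α y)) (S.frame i δ y) =
      (S.structureFun i α β δ y - S.structureFun i β δ α y + S.structureFun i δ α β y) / 2 := by
  have hskew (α β δ : Fin 4) :=
    S.metric_connection_frame_add_swap hD i β δ hy (S.frame i α y)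
  rw [S.structureFun_eq_sub hD i α β δ hy, S.structureFun_eq_sub hD i β δ α hy,
    S.structureFun_eq_sub hD i δ α β hy]
  linear_combination (hskew β δ α + hskew α β δ - hskew δ α β) / 2

theorem continuousOn_connMatrix_frame (i : S.Idx) (κ : Fin 4) :
    ContinuousOn (fun y ↦ S.connMatrix D i (S.frame i κ y)) (S.dom i) := by
  have hstructure := S.continuousOn_structureFun i
  have hcoeff (α β : Fin 4) : ContinuousOn (fun y ↦
      g.metric y (D (S.frame i α) y (S.frame i κ y)) (S.frame i β y)) (S.dom i) := by
    refine ContinuousOn.congr ?_ fun y hy ↦ S.metric_connection_frame hD i κ α β hy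
    fun_prop
  unfold connMatrix
  fun_prop

end LeviCivita

theorem connMatrix_sum_smul (D : Connection N) (i : S.Idx) {y : N} {ι : Type*} (s : Finset ι)
    (c : ι → ℝ) (v : ι → TangentSpace (𝓡 4) y) :
    S.connMatrix D i (∑ κ ∈ s, c κ • v κ) = ∑ κ ∈ s, c κ • S.connMatrix D i (v κ) := by
  simp only [connMatrix, Finset.smul_sum]
  symm
  rw [Finset.sum_comm]
  refine Finset.sum_congr rfl fun α _ ↦ ?_
  rw [Finset.sum_comm]
  refine Finset.sum_congr rfl fun β _ ↦ ?_
  simp only [map_sum, map_smul, sum_apply, smul_apply, smul_eq_mul, Finset.mul_sum,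
    Finset.sum_smul, Finset.smul_sum, smul_smul]
  exact Finset.sum_congr rfl fun κ _ ↦ by ring_nf

theorem connMatrix_eq_sum (D : Connection N) (i : S.Idx) {y : N} (hy : y ∈ S.dom i)
    (v : TangentSpace (𝓡 4) y) :
    S.connMatrix D i v =
      ∑ κ, frameCoord g (fun α ↦ S.frame i α y) v κ • S.connMatrix D i (S.frame i κ y) := by
  conv_lhs => rw [← sum_frameCoord_smul g (S.orthonormal i y hy) v]
  exact S.connMatrix_sum_smul D i _ _ _

theorem continuousOn_connMatrix_velocity {D : Connection N} (hD : g.IsLeviCivita D) (i : S.Idx)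
    {c : ℝ → N} {s : Set ℝ} (hc : ContMDiffOn 𝓘(ℝ, ℝ) (𝓡 4) 1 c s) (hs : UniqueDiffOn ℝ s)
    (hcs : MapsTo c s (S.dom i)) :
    ContinuousOn (fun t ↦
      S.connMatrix D i (mfderivWithin 𝓘(ℝ, ℝ) (𝓡 4) c s t (1 : ℝ) : TangentSpace (𝓡 4) (c t)))
      s := by
  have hcoord (κ : Fin 4) : ContinuousOn (fun t ↦ frameCoord g (fun α ↦ S.frame i α (c t))
      (mfderivWithin 𝓘(ℝ, ℝ) (𝓡 4) c s t (1 : ℝ)) κ) s := fun t ht ↦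
    continuousWithinAt_const.mul (g.contMDiffWithinAt_metric (n := 0)
      (((S.contMDiffAt_frame i κ (hcs ht)).of_le (by simp)).comp_contMDiffWithinAt t
        ((hc t ht).of_le (by simp)))
      (contMDiffOn_velocity hc (by simp) hs t ht)).continuousWithinAt
  have hframe (κ : Fin 4) : ContinuousOn (fun t ↦ S.connMatrix D i (S.frame i κ (c t))) s :=
    (S.continuousOn_connMatrix_frame hD i κ).comp hc.continuousOn hcs
  refine ContinuousOn.congr ?_ fun t ht ↦ S.connMatrix_eq_sum D i (hcs ht) _
  fun_prop

end SpinStructure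

namespace SpacelikeHypersurface

variable {N : Type*} [TopologicalSpace N] [ChartedSpace (EuclideanSpace ℝ (Fin 4)) N]
  [IsManifold (𝓡 4) ∞ N] {M : Type*} [TopologicalSpace M] [ChartedSpace (EuclideanHalfSpace 3) M]
  [IsManifold (𝓡∂ 3) ∞ M] {g : Spacetime N} (F : SpacelikeHypersurface g M)
  {S : SpinStructure g (range F.emb)}

section Components

theorem preimage_dom_mem_nhds {i : S.Idx} {x : M} (hx : F.emb x ∈ S.dom i) :
    F.emb ⁻¹' S.dom i ∈ nhds x :=
  ((S.isOpen_dom i).preimage F.contMDiff_emb.continuous).mem_nhds hx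

theorem exists_mem_dom (S : SpinStructure g (range F.emb)) (x : M) : ∃ i, F.emb x ∈ S.dom i :=
  mem_iUnion.1 (S.covers (mem_range_self x))

variable {F}

theorem component_eq_zero_iff {χ : F.SpinorField S} {i : S.Idx} {x : M}
    (hx : F.emb x ∈ S.dom i) : F.component χ i x = 0 ↔ χ x = 0 := by
  rw [component, dif_pos hx]
  refine ⟨fun h ↦ Subtype.ext (funext fun j ↦ ?_), fun h ↦ by simp [h]⟩
  rw [(χ x).2 j ⟨i, hx⟩, h]
  simp

theorem IsSmooth.contMDiffAt_component {χ : F.SpinorField S} (hχ : F.IsSmooth χ) {i : S.Idx}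
    {x : M} (hx : F.emb x ∈ S.dom i) :
    ContMDiffAt (𝓡∂ 3) 𝓘(ℝ, Fin 4 → ℂ) ∞ (F.component χ i) x :=
  (hχ i).contMDiffAt (F.preimage_dom_mem_nhds hx)

theorem IsSmooth.mdifferentiableAt_component {χ : F.SpinorField S} (hχ : F.IsSmooth χ) {i : S.Idx}
    {x : M} (hx : F.emb x ∈ S.dom i) :
    MDifferentiableAt (𝓡∂ 3) 𝓘(ℝ, Fin 4 → ℂ) (F.component χ i) x :=
  (hχ.contMDiffAt_component hx).mdifferentiableAt (by simp)

end Components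

section UniqueContinuation

theorem push_velocity {c : ℝ → M} {s : Set ℝ} {t : ℝ}
    (hc : MDifferentiableWithinAt 𝓘(ℝ, ℝ) (𝓡∂ 3) c s t) (hs : UniqueDiffWithinAt ℝ s t) :
    F.push (mfderivWithin 𝓘(ℝ, ℝ) (𝓡∂ 3) c s t (1 : ℝ)) =
      mfderivWithin 𝓘(ℝ, ℝ) (𝓡 4) (F.emb ∘ c) s t (1 : ℝ) := by
  rw [mfderiv_comp_mfderivWithin t ((F.contMDiff_emb (c t)).mdifferentiableAt (by simp)) hc
    hs.uniqueMDiffWithinAt]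
  rfl

variable {F} {D : Connection N} {χ : F.SpinorField S}

theorem IsParallel.hasDerivWithinAt_component_comp (hχ : F.IsSmooth χ) (hχ' : F.IsParallel D χ)
    {i : S.Idx} {c : ℝ → M} {s : Set ℝ} {t : ℝ}
    (hc : MDifferentiableWithinAt 𝓘(ℝ, ℝ) (𝓡∂ 3) c s t) (ht : F.emb (c t) ∈ S.dom i) :
    HasDerivWithinAt (F.component χ i ∘ c)
      (-S.connMatrix D i (F.push (mfderivWithin 𝓘(ℝ, ℝ) (𝓡∂ 3) c s t (1 : ℝ))) *ᵥ
        F.component χ i (c t)) s t := by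
  let deriv : ℝ →L[ℝ] Fin 4 → ℂ := mfderiv (𝓡∂ 3) 𝓘(ℝ, Fin 4 → ℂ) (F.component χ i) (c t) ∘L
    mfderivWithin 𝓘(ℝ, ℝ) (𝓡∂ 3) c s t
  have hderiv : HasFDerivWithinAt (F.component χ i ∘ c) deriv s t :=
    ((hχ.mdifferentiableAt_component ht).hasMFDerivAt.comp_hasMFDerivWithinAt t
      hc.hasMFDerivWithinAt).hasFDerivWithinAt
  rw [Matrix.neg_mulVec]
  exact hderiv.hasDerivWithinAt.congr_deriv (eq_neg_of_add_eq_zero_left (hχ' (c t) i ht _))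

theorem IsParallel.eq_zero_of_curve (hD : g.IsLeviCivita D) (hχ : F.IsSmooth χ)
    (hχ' : F.IsParallel D χ) {i : S.Idx} {c : ℝ → M}
    (hc : ContMDiffOn 𝓘(ℝ, ℝ) (𝓡∂ 3) 1 c (Icc 0 1)) (hci : MapsTo c (Icc 0 1) (F.emb ⁻¹' S.dom i))
    (h0 : χ (c 0) = 0) : χ (c 1) = 0 := by
  have hs : UniqueDiffOn ℝ (Icc (0 : ℝ) 1) := uniqueDiffOn_Icc one_pos
  have hdiff : MDifferentiableOn 𝓘(ℝ, ℝ) (𝓡∂ 3) c (Icc 0 1) := hc.mdifferentiableOn one_ne_zero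
  have hemb : ContMDiffOn 𝓘(ℝ, ℝ) (𝓡 4) 1 (F.emb ∘ c) (Icc 0 1) :=
    (F.contMDiff_emb.of_le (by simp)).comp_contMDiffOn hc
  have hcont : ContinuousOn (fun t ↦ -S.connMatrix D i
      (F.push (mfderivWithin 𝓘(ℝ, ℝ) (𝓡∂ 3) c (Icc 0 1) t (1 : ℝ)))) (Icc 0 1) :=
    ((S.continuousOn_connMatrix_velocity hD i hemb hs hci).congr
      fun t ht ↦ congrArg (S.connMatrix D i) (F.push_velocity (hdiff t ht) (hs t ht))).neg
  have hzero : EqOn (F.component χ i ∘ c) 0 (Icc 0 1) :=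
    eqOn_zero_of_hasDerivWithinAt_mulVec hcont
      (fun t ht ↦ hχ'.hasDerivWithinAt_component_comp hχ (hdiff t ht) (hci ht))
      ((component_eq_zero_iff (hci (left_mem_Icc.2 zero_le_one))).2 h0)
  have h1 : (1 : ℝ) ∈ Icc (0 : ℝ) 1 := right_mem_Icc.2 zero_le_one
  exact (component_eq_zero_iff (hci h1)).1 (hzero h1)

theorem IsSmooth.isClosed_setOf_eq_zero (hχ : F.IsSmooth χ) : IsClosed {x | χ x = 0} := by
  rw [← isOpen_compl_iff, isOpen_iff_mem_nhds]
  intro x hx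
  obtain ⟨i, hi⟩ := F.exists_mem_dom S x
  filter_upwards [F.preimage_dom_mem_nhds hi,
    (hχ.contMDiffAt_component hi).continuousAt.eventually_ne (mt (component_eq_zero_iff hi).1 hx)]
    with y hy hy'
  exact mt (component_eq_zero_iff hy).2 hy'

theorem IsParallel.isOpen_setOf_eq_zero (hD : g.IsLeviCivita D) (hχ : F.IsSmooth χ)
    (hχ' : F.IsParallel D χ) : IsOpen {x | χ x = 0} := by
  refine isOpen_iff_mem_nhds.2 fun x hx ↦ ?_
  obtain ⟨i, hi⟩ := F.exists_mem_dom S x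
  filter_upwards [eventually_exists_contMDiffOn_curve (𝓡∂ 3) (n := 1) (F.preimage_dom_mem_nhds hi)]
  rintro y ⟨c, hc, hci, rfl, rfl⟩
  exact hχ'.eq_zero_of_curve hD hχ hc hci hx

theorem IsParallel.eq_zero_of_apply_eq_zero [PreconnectedSpace M] (hD : g.IsLeviCivita D)
    (hχ : F.IsSmooth χ) (hχ' : F.IsParallel D χ) {x₀ : M} (h0 : χ x₀ = 0) : χ = 0 := by
  have hclopen : IsClopen {x | χ x = 0} :=
    ⟨hχ.isClosed_setOf_eq_zero, hχ'.isOpen_setOf_eq_zero hD hχ⟩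
  exact funext (eq_univ_iff_forall.1 (hclopen.eq_univ ⟨x₀, h0⟩))

end UniqueContinuation

section ParallelSpinors

variable {F}

theorem component_zero (i : S.Idx) : F.component (0 : F.SpinorField S) i = 0 := by
  funext x
  by_cases hx : F.emb x ∈ S.dom i <;> simp [component, hx]

theorem component_add (φ ψ : F.SpinorField S) (i : S.Idx) :
    F.component (φ + ψ) i = F.component φ i + F.component ψ i := by
  funext x
  by_cases hx : F.emb x ∈ S.dom i <;> simp [component, hx]

theorem component_smul (a : ℂ) (φ : F.SpinorField S) (i : S.Idx) :
    F.component (a • φ) i = a • F.component φ i := by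
  funext x
  by_cases hx : F.emb x ∈ S.dom i <;> simp [component, hx]

variable {φ ψ : F.SpinorField S}

theorem isSmooth_zero : F.IsSmooth (0 : F.SpinorField S) := fun i ↦ by
  rw [component_zero]
  exact contMDiffOn_const

theorem IsSmooth.add (hφ : F.IsSmooth φ) (hψ : F.IsSmooth ψ) : F.IsSmooth (φ + ψ) := fun i ↦ by
  rw [component_add]
  exact (hφ i).add (hψ i)

theorem IsSmooth.smul (a : ℂ) (hφ : F.IsSmooth φ) : F.IsSmooth (a • φ) := fun i ↦ by
  rw [component_smul]
  exact (contDiff_const_smul a).contMDiff.comp_contMDiffOn (hφ i)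

variable {D : Connection N} {i : S.Idx} {x : M}

theorem mfderiv_component_add (hφ : F.IsSmooth φ) (hψ : F.IsSmooth ψ) (hx : F.emb x ∈ S.dom i)
    (X : TangentSpace (𝓡∂ 3) x) :
    (show Fin 4 → ℂ from mfderiv (𝓡∂ 3) 𝓘(ℝ, Fin 4 → ℂ) (F.component (φ + ψ) i) x X) =
      (show Fin 4 → ℂ from mfderiv (𝓡∂ 3) 𝓘(ℝ, Fin 4 → ℂ) (F.component φ i) x X) +
        (show Fin 4 → ℂ from mfderiv (𝓡∂ 3) 𝓘(ℝ, Fin 4 → ℂ) (F.component ψ i) x X) := by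
  rw [component_add, mfderiv_add (hφ.mdifferentiableAt_component hx)
    (hψ.mdifferentiableAt_component hx)]
  rfl

theorem mfderiv_component_smul (a : ℂ) (hφ : F.IsSmooth φ) (hx : F.emb x ∈ S.dom i)
    (X : TangentSpace (𝓡∂ 3) x) :
    (show Fin 4 → ℂ from mfderiv (𝓡∂ 3) 𝓘(ℝ, Fin 4 → ℂ) (F.component (a • φ) i) x X) =
      a • (show Fin 4 → ℂ from mfderiv (𝓡∂ 3) 𝓘(ℝ, Fin 4 → ℂ) (F.component φ i) x X) := by
  let scale : (Fin 4 → ℂ) →L[ℝ] Fin 4 → ℂ := a • ContinuousLinearMap.id ℝ (Fin 4 → ℂ)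
  have hscale : F.component (a • φ) i = scale ∘ F.component φ i := component_smul a φ i
  rw [hscale, (scale.hasMFDerivAt.comp x
    (hφ.mdifferentiableAt_component hx).hasMFDerivAt).mfderiv]
  rfl

theorem spinDeriv_zero (X : TangentSpace (𝓡∂ 3) x) :
    F.spinDeriv D (0 : F.SpinorField S) i x X = 0 := by
  have hderiv : mfderiv (𝓡∂ 3) 𝓘(ℝ, Fin 4 → ℂ) (0 : M → Fin 4 → ℂ) x = 0 := mfderiv_const
  rw [spinDeriv, component_zero, hderiv, Pi.zero_apply, Matrix.mulVec_zero, add_zero]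
  rfl

theorem spinDeriv_add (hφ : F.IsSmooth φ) (hψ : F.IsSmooth ψ) (hx : F.emb x ∈ S.dom i)
    (X : TangentSpace (𝓡∂ 3) x) :
    F.spinDeriv D (φ + ψ) i x X = F.spinDeriv D φ i x X + F.spinDeriv D ψ i x X := by
  rw [spinDeriv, mfderiv_component_add hφ hψ hx, component_add, Pi.add_apply, Matrix.mulVec_add]
  exact add_add_add_comm (G := Fin 4 → ℂ) _ _ _ _

theorem spinDeriv_smul (a : ℂ) (hφ : F.IsSmooth φ) (hx : F.emb x ∈ S.dom i)
    (X : TangentSpace (𝓡∂ 3) x) : F.spinDeriv D (a • φ) i x X = a • F.spinDeriv D φ i x X := by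
  rw [spinDeriv, mfderiv_component_smul a hφ hx, component_smul, Pi.smul_apply,
    Matrix.mulVec_smul]
  exact (smul_add (A := Fin 4 → ℂ) a _ _).symm

variable (F S D) in
/-- The space of smooth spinor fields `φ` with `∇̃_X φ = 0` for all `X` tangent to `M`. The
theorem says that evaluation at a point is injective on it. -/
def parallelSpinors : Submodule ℂ (F.SpinorField S) where
  carrier := {χ | F.IsSmooth χ ∧ F.IsParallel D χ}
  zero_mem' := ⟨isSmooth_zero, fun _ _ _ X ↦ spinDeriv_zero X⟩
  add_mem' := fun ⟨hφ, hφ'⟩ ⟨hψ, hψ'⟩ ↦ ⟨hφ.add hψ, fun x i hx X ↦ by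
    rw [spinDeriv_add hφ hψ hx, hφ' x i hx, hψ' x i hx, add_zero]⟩
  smul_mem' := fun a _ ⟨hφ, hφ'⟩ ↦ ⟨hφ.smul a, fun x i hx X ↦ by
    rw [spinDeriv_smul a hφ hx, hφ' x i hx, smul_zero]⟩

theorem disjoint_parallelSpinors_ker_proj [PreconnectedSpace M] (hD : g.IsLeviCivita D) (x : M) :
    Disjoint (F.parallelSpinors S D)
      (LinearMap.ker (LinearMap.proj x : F.SpinorField S →ₗ[ℂ] S.fiber (F.emb x))) :=
  Submodule.disjoint_def.2 fun _ ⟨hχ, hχ'⟩ h0 ↦ hχ'.eq_zero_of_apply_eq_zero hD hχ h0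

end ParallelSpinors

end SpacelikeHypersurface

end HypersurfaceSpinor

theorem proposition2_general
    {N : Type*} [TopologicalSpace N] [ChartedSpace (EuclideanSpace ℝ (Fin 4)) N]
    [IsManifold (𝓡 4) ∞ N]
    {M : Type*} [TopologicalSpace M] [ChartedSpace (EuclideanHalfSpace 3) M]
    [IsManifold (𝓡∂ 3) ∞ M] [PreconnectedSpace M]
    {g : HypersurfaceSpinor.Spacetime N} {F : HypersurfaceSpinor.SpacelikeHypersurface g M}
    {S : HypersurfaceSpinor.SpinStructure g (range F.emb)}
    {D : HypersurfaceSpinor.Connection N} (hD : g.IsLeviCivita D)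
    {ι : Type*} {φ : ι → F.SpinorField S} (hφ : ∀ j, F.IsSmooth (φ j))
    (hφ' : ∀ j, F.IsParallel D (φ j)) (hind : LinearIndependent ℂ φ) (x : M) :
    LinearIndependent ℂ (fun j ↦ φ j x) := by
  have hspan : Submodule.span ℂ (range φ) ≤ F.parallelSpinors S D :=
    Submodule.span_le.2 (range_subset_iff.2 fun j ↦ ⟨hφ j, hφ' j⟩)
  have hdisj := (F.disjoint_parallelSpinors_ker_proj hD x).mono_left hspan
  exact hind.map (f := LinearMap.proj x) hdisj

theorem proposition2
    {N : Type*} [TopologicalSpace N] [T2Space N] [SecondCountableTopology N]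
    [ChartedSpace (EuclideanSpace ℝ (Fin 4)) N] [IsManifold (𝓡 4) ∞ N]
    {M : Type*} [TopologicalSpace M] [T2Space M] [SecondCountableTopology M]
    [ChartedSpace (EuclideanHalfSpace 3) M] [IsManifold (𝓡∂ 3) ∞ M] [ConnectedSpace M]
    (g : HypersurfaceSpinor.Spacetime N)
    (F : HypersurfaceSpinor.SpacelikeHypersurface g M)
    (S : HypersurfaceSpinor.SpinStructure g (range F.emb))
    (D : HypersurfaceSpinor.Connection N) (hD : g.IsLeviCivita D)
    (e₀ : ∀ x : M, TangentSpace (𝓡 4) (F.emb x)) (he₀ : ∀ x, F.IsFutureUnitNormal x (e₀ x))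
    (eᵣ : ∀ x : M, TangentSpace (𝓡∂ 3) x)
    (heᵣ : ∀ x ∈ (𝓡∂ 3).boundary M, F.IsOutwardUnitNormal x (eᵣ x))
    {l : ℕ} (B : Fin l → Set M) (hB : HypersurfaceSpinor.AreBoundarySpheres B)
    (φ ψ : F.SpinorField S) (hφ : F.IsSmooth φ) (hψ : F.IsSmooth ψ)
    (hφ' : F.IsParallel D φ) (hψ' : F.IsParallel D ψ)
    (k : Fin l)
    (hind :
      LinearIndependent ℂ
        ![fun x : B k => F.projPlus S (e₀ x) (eᵣ x) (φ x),
          fun x : B k => F.projPlus S (e₀ x) (eᵣ x) (ψ x)] ∨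
      LinearIndependent ℂ
        ![fun x : B k => F.projMinus S (e₀ x) (eᵣ x) (φ x),
          fun x : B k => F.projMinus S (e₀ x) (eᵣ x) (ψ x)]) :
    ∀ x : M, LinearIndependent ℂ ![φ x, ψ x] := by
  have hsections : LinearIndependent ℂ ![φ, ψ] := hind.elim
    (HypersurfaceSpinor.linearIndependent_pair_of_pi_map (V := fun x ↦ S.fiber (F.emb x))
      fun y : B k ↦ F.projPlus S (e₀ y) (eᵣ y))
    (HypersurfaceSpinor.linearIndependent_pair_of_pi_map (V := fun x ↦ S.fiber (F.emb x))
      fun y : B k ↦ F.projMinus S (e₀ y) (eᵣ y))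
  intro x
  convert proposition2_general hD (Fin.forall_fin_two.2 ⟨hφ, hψ⟩) (Fin.forall_fin_two.2 ⟨hφ', hψ'⟩)
    hsections x using 1
  exact funext (Fin.forall_fin_two.2 ⟨rfl, rfl⟩)
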